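/- Let $Y \subset \mathbb R^n$ be an $n$-dimensional compact connected topological ($C^0$-) manifold with boundary (in the topology induced from $\mathbb R^n$), let $\operatorname{Int} Y$ be the set of its interior points and $\partial Y$ the set of its boundary points. For $x, y \in Y$ put $$\rho_Y(x,y) = \liminf_{x' \to x,\ y' \to y;\ x', y' \in \operatorname{Int} Y} \ \inf_{\gamma} \, l(\gamma) \in [0,\infty],$$ where the infimum is taken over all smooth non-constant paths $\gamma : [0,1] \to \operatorname{Int} Y$ with $\gamma(0) = x'$ and $\gamma(1) = y'$, and $l(\gamma)$ is the Euclidean length of $\gamma$ (the infimum of the empty set is $\infty$). We say that $Y$ satisfies condition (i) if $\rho_Y(x,y) < \infty$ for all $x, y \in Y$. **Theorem 2.2.** For every integer $n \ge 3$ there exists an $n$-dimensional compact connected $C^0$-manifold $Y \subset \mathbb R^n$ with nonempty boundary $\partial Y$, homeomorphic to the closed unit ball of $\mathbb R^n$, that satisfies condition (i), but for which $\rho_Y$ violates the triangle inequality (so $\rho_Y$ is not a metric on $Y$): there are points $A, D \in \operatorname{Int} Y$ and $O \in \partial Y$ with $$\rho_Y(A,O) + \rho_Y(O,D) < \rho_Y(A,D).$$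 -/

import Mathlib

open Set Filter
open scoped Topology ENNReal ContDiff Manifold

/-- `γ`, restricted to `[0,1]`, is a smooth non-constant path in the set `U ⊆ ℝⁿ` that starts
at `x` and ends at `y`. -/
structure IsSmoothPathIn {n : ℕ} (U : Set (EuclideanSpace ℝ (Fin n)))
    (x y : EuclideanSpace ℝ (Fin n)) (γ : ℝ → EuclideanSpace ℝ (Fin n)) : Prop where
  smooth : ContDiffOn ℝ ∞ γ (Icc 0 1)
  mapsTo : MapsTo γ (Icc 0 1) U
  source : γ 0 = x
  target : γ 1 = y
  nonconst : ∃ t ∈ Icc (0 : ℝ) 1, γ t ≠ γ 0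

/-- The infimum of the lengths of the smooth paths from `x` to `y` in `U` (the value is `∞` if
there is no such path). The length of a path is its total variation. -/
noncomputable def pathInfLength {n : ℕ} (U : Set (EuclideanSpace ℝ (Fin n)))
    (x y : EuclideanSpace ℝ (Fin n)) : ℝ≥0∞ :=
  ⨅ (γ : ℝ → EuclideanSpace ℝ (Fin n)) (_ : IsSmoothPathIn U x y γ), eVariationOn γ (Icc 0 1)

/-- `Int Y`: the set of interior points of the topological manifold with boundary `Y ⊆ ℝⁿ`. -/
def manifoldInt {n : ℕ} [NeZero n] (Y : Set (EuclideanSpace ℝ (Fin n)))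
    [ChartedSpace (EuclideanHalfSpace n) Y] : Set (EuclideanSpace ℝ (Fin n)) :=
  Subtype.val '' ((𝓡∂ n).interior Y)

/-- `∂Y`: the set of boundary points of the topological manifold with boundary `Y ⊆ ℝⁿ`. -/
def manifoldBdry {n : ℕ} [NeZero n] (Y : Set (EuclideanSpace ℝ (Fin n)))
    [ChartedSpace (EuclideanHalfSpace n) Y] : Set (EuclideanSpace ℝ (Fin n)) :=
  Subtype.val '' ((𝓡∂ n).boundary Y)

/-- `ρ_Y(x, y)`: the lower limit, as `x' → x` and `y' → y` with `x', y' ∈ Int Y`, of the infimum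
of the lengths of the smooth paths that join `x'` and `y'` in `Int Y`. -/
noncomputable def rhoY {n : ℕ} [NeZero n] (Y : Set (EuclideanSpace ℝ (Fin n)))
    [ChartedSpace (EuclideanHalfSpace n) Y] (x y : EuclideanSpace ℝ (Fin n)) : ℝ≥0∞ :=
  liminf (fun p : EuclideanSpace ℝ (Fin n) × EuclideanSpace ℝ (Fin n) =>
      pathInfLength (manifoldInt Y) p.1 p.2)
    (𝓝[manifoldInt Y] x ×ˢ 𝓝[manifoldInt Y] y)

/-- The condition that `ρ_Y` is finite on `Y × Y`. -/
def RhoFinite {n : ℕ} [NeZero n] (Y : Set (EuclideanSpace ℝ (Fin n)))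
    [ChartedSpace (EuclideanHalfSpace n) Y] : Prop :=
  ∀ x ∈ Y, ∀ y ∈ Y, rhoY Y x y < ⊤

/-! Let `w` be `roughFun`, a bounded continuous function that oscillates too much to be Lipschitz.
`Y` is a thin thickening, in the direction `j`, of the cone with apex O = 0 over the graph of `w`:
the base is a ball that touches the hyperplane of height `p 0 = 0` at O, a point of height x and
slope s = `p i / p 0` has coordinate `j` near x · w(s), and the thickness is of order x², which is
negligible beside x at the apex. Three different coordinates are used, whence n ≥ 3.

Moving radially is cheap. The slope is constant on a ray, so the rough function contributes only a
linear term there, and rays of slope 0 and 1 with j-coordinate 0 are not moved at all because `w`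
vanishes at integers. So A and D, on these two rays, are joined to points arbitrarily near O by
paths of length at most ‖A‖ = 1/4 and ‖D‖ = 1/√8, whose sum is below 1
(`liminf_pathInfLength_flat_ray_le`). Rays also give finiteness of ρ: each point of `Y`, boundary
included, is approached along one, and the interior is open and connected
(`liminf_pathInfLength_lt_top`).

Changing the slope is expensive at every height (`one_le_pathInfLength`). At height x take N with
3^N x of order 256. On a slope cell of size 6^(-N) the function x · w varies by about x · 2^(-N),
far more than the thickness x², so crossing the cell costs at least 8 / 6^N (`le_dist_of_cell`).
Length is thus at least 4 times the change of slope, up to a small error at the end. Interior paths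
have positive height and never pass through O, so ρ(A, D) ≥ 1. -/

/-- The closed ball of radius `1/2` that touches the hyperplane `p 0 = 0` at the origin. -/
def poleBall (n : ℕ) [NeZero n] : Set (EuclideanSpace ℝ (Fin n)) := {p | ‖p‖ ^ 2 ≤ p 0}

/-- The first vector of the standard basis. -/
noncomputable def firstVec (n : ℕ) [NeZero n] : EuclideanSpace ℝ (Fin n) :=
  EuclideanSpace.single 0 1

/-! ### The ball tangent to a hyperplane as a manifold with boundary -/

section PoleBall

variable {n : ℕ} [NeZero n]

theorem firstVec_zero : firstVec n 0 = 1 := by simp [firstVec]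

theorem norm_firstVec : ‖firstVec n‖ = 1 := by simp [firstVec]

theorem inner_firstVec (p : EuclideanSpace ℝ (Fin n)) : inner ℝ p (firstVec n) = p 0 := by
  simp [firstVec, EuclideanSpace.inner_single_right]

theorem norm_firstVec_sub_sq (p : EuclideanSpace ℝ (Fin n)) :
    ‖firstVec n - p‖ ^ 2 = ‖p‖ ^ 2 - 2 * p 0 + 1 := by
  rw [norm_sub_rev, norm_sub_sq_real, inner_firstVec, norm_firstVec]; ring

theorem norm_firstVec_add_sq (p : EuclideanSpace ℝ (Fin n)) :
    ‖firstVec n + p‖ ^ 2 = ‖p‖ ^ 2 + 2 * p 0 + 1 := by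
  rw [add_comm, norm_add_sq_real, inner_firstVec, norm_firstVec]; ring

theorem zero_mem_poleBall : (0 : EuclideanSpace ℝ (Fin n)) ∈ poleBall n := by
  simp [poleBall]

/-- The homeomorphism `p ↦ (e + p) / 2` from the unit ball to the ball `poleBall`. -/
noncomputable def closedBallHomeoPoleBall :
    Metric.closedBall (0 : EuclideanSpace ℝ (Fin n)) 1 ≃ₜ poleBall n where
  toFun p := ⟨(1 / 2 : ℝ) • (firstVec n + p), by
    have h := norm_firstVec_add_sq p.1
    have hp : ‖p.1‖ ≤ 1 := mem_closedBall_zero_iff.1 p.2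
    have hp2 : ‖p.1‖ ^ 2 ≤ 1 := by nlinarith [norm_nonneg p.1]
    simp only [poleBall, mem_ofPred_eq, norm_smul, PiLp.smul_apply, PiLp.add_apply,
      firstVec_zero, mul_pow, h, smul_eq_mul]
    norm_num
    linarith⟩
  invFun p := ⟨(2 : ℝ) • p.1 - firstVec n, by
    have h := norm_firstVec_sub_sq ((2 : ℝ) • p.1)
    have hp : ‖p.1‖ ^ 2 ≤ p.1 0 := p.2
    rw [norm_sub_rev] at h
    have : ‖(2 : ℝ) • p.1 - firstVec n‖ ^ 2 ≤ 1 := by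
      rw [h]; simp only [norm_smul, PiLp.smul_apply, smul_eq_mul, mul_pow]; norm_num; linarith
    rw [mem_closedBall_zero_iff]
    nlinarith [norm_nonneg ((2 : ℝ) • p.1 - firstVec n)]⟩
  left_inv p := by ext1; simp [smul_smul]
  right_inv p := by ext1; simp [smul_smul]
  continuous_toFun := by fun_prop
  continuous_invFun := by fun_prop

/-- The reflection of `poleBall` in its centre. -/
noncomputable def poleBallFlip : poleBall n ≃ₜ poleBall n where
  toFun p := ⟨firstVec n - p, by
    have h := norm_firstVec_sub_sq p.1
    have hp : ‖p.1‖ ^ 2 ≤ p.1 0 := p.2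
    simp only [poleBall, mem_ofPred_eq, h, PiLp.sub_apply, firstVec_zero]; linarith⟩
  invFun p := ⟨firstVec n - p, by
    have h := norm_firstVec_sub_sq p.1
    have hp : ‖p.1‖ ^ 2 ≤ p.1 0 := p.2
    simp only [poleBall, mem_ofPred_eq, h, PiLp.sub_apply, firstVec_zero]; linarith⟩
  left_inv p := by ext1; simp
  right_inv p := by ext1; simp
  continuous_toFun := by fun_prop
  continuous_invFun := by fun_prop

/-- The reflection of space that sends the complement of the half-space into the half-space. -/
noncomputable def halfSpaceFold (v : EuclideanSpace ℝ (Fin n)) : EuclideanHalfSpace n :=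
  ⟨v + (|v 0| - v 0) • firstVec n, by simp [firstVec_zero]⟩

theorem continuous_halfSpaceFold : Continuous (halfSpaceFold (n := n)) := by
  unfold halfSpaceFold; fun_prop

theorem halfSpaceFold_val {v : EuclideanSpace ℝ (Fin n)} (hv : 0 ≤ v 0) :
    (halfSpaceFold v).1 = v := by
  simp [halfSpaceFold, abs_of_nonneg hv]

theorem poleBall_inv_nonneg {p : EuclideanSpace ℝ (Fin n)} (hp : p ∈ poleBall n) (h0 : p ≠ 0) :
    0 ≤ ((‖p‖ ^ 2)⁻¹ • p - firstVec n) 0 := by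
  have : 0 < ‖p‖ ^ 2 := by positivity
  have hp : ‖p‖ ^ 2 ≤ p 0 := hp
  simp only [PiLp.sub_apply, PiLp.smul_apply, firstVec_zero, smul_eq_mul, sub_nonneg]
  rw [inv_mul_eq_div, le_div_iff₀ this]; linarith

theorem one_le_halfSpace_add (h : EuclideanHalfSpace n) : 1 ≤ (h.1 + firstVec n) 0 := by
  have := h.2
  simp only [PiLp.add_apply, firstVec_zero]; linarith

theorem halfSpace_add_ne_zero (h : EuclideanHalfSpace n) : h.1 + firstVec n ≠ 0 := fun h0 => by
  have := one_le_halfSpace_add h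
  rw [h0] at this
  norm_num at this

/-- The inversion in the unit sphere, followed by a translation, as a chart on the complement of
the origin in `poleBall`. -/
noncomputable def poleBallInversion :
    OpenPartialHomeomorph (poleBall n) (EuclideanHalfSpace n) where
  -- The fold is the identity on the values that matter. At the origin the formula gives the junk
  -- value −e, outside the half-space, and the fold makes the map total.
  toFun p := halfSpaceFold ((‖p.1‖ ^ 2)⁻¹ • p.1 - firstVec n)
  invFun h := ⟨(‖h.1 + firstVec n‖ ^ 2)⁻¹ • (h.1 + firstVec n), by
    have h1 := one_le_halfSpace_add h
    have h2 : 0 < ‖h.1 + firstVec n‖ ^ 2 := by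
      have := halfSpace_add_ne_zero h
      positivity
    simp only [poleBall, mem_ofPred_eq, norm_smul, norm_inv, norm_pow, norm_norm, mul_pow]
    rw [PiLp.smul_apply, smul_eq_mul, inv_pow, pow_two (‖h.1 + firstVec n‖ ^ 2), mul_inv, mul_assoc,
      inv_mul_cancel₀ h2.ne']
    gcongr⟩
  source := {p | p.1 ≠ 0}
  target := univ
  map_source' _ _ := mem_univ _
  map_target' h _ := by
    have h1 := halfSpace_add_ne_zero h
    have h2 : (‖h.1 + firstVec n‖ ^ 2)⁻¹ ≠ 0 := by simpa using h1
    exact smul_ne_zero h2 h1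
  left_inv' p hp := by
    have hp : p.1 ≠ 0 := hp
    have : ‖p.1‖ ≠ 0 := by simpa using hp
    ext1
    simp only [halfSpaceFold_val (poleBall_inv_nonneg p.2 hp), sub_add_cancel, norm_smul, norm_inv,
      norm_pow, norm_norm, smul_smul]
    convert one_smul ℝ p.1
    field_simp
  right_inv' h _ := by
    have h1 : ‖h.1 + firstVec n‖ ≠ 0 := by simpa using halfSpace_add_ne_zero h
    have : (‖(‖h.1 + firstVec n‖ ^ 2)⁻¹ • (h.1 + firstVec n)‖ ^ 2)⁻¹ •
        ((‖h.1 + firstVec n‖ ^ 2)⁻¹ • (h.1 + firstVec n)) - firstVec n = h.1 := by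
      rw [sub_eq_iff_eq_add, smul_smul]
      simp only [norm_smul, norm_inv, norm_pow, norm_norm]
      convert one_smul ℝ (h.1 + firstVec n)
      field_simp
    apply Subtype.ext
    simp only [this]
    exact halfSpaceFold_val h.2
  open_source := isOpen_ne_fun continuous_subtype_val continuous_const
  open_target := isOpen_univ
  continuousOn_toFun := by
    have h1 : Continuous fun p : poleBall n => ‖p.1‖ ^ 2 := by fun_prop
    refine continuous_halfSpaceFold.comp_continuousOn (ContinuousOn.sub (ContinuousOn.smul
      (h1.continuousOn.inv₀ fun p hp => ?_) continuous_subtype_val.continuousOn) continuousOn_const)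
    have : p.1 ≠ 0 := hp
    positivity
  continuousOn_invFun := by
    have h2 (h : EuclideanHalfSpace n) : ‖h.1 + firstVec n‖ ^ 2 ≠ 0 :=
      pow_ne_zero 2 (norm_ne_zero_iff.2 (halfSpace_add_ne_zero h))
    have h1 : Continuous fun h : EuclideanHalfSpace n => h.1 + firstVec n :=
      continuous_subtype_val.add continuous_const
    exact (Continuous.subtype_mk (((h1.norm.pow 2).inv₀ h2).smul h1) _).continuousOn

theorem poleBallInversion_zero {p : poleBall n} (hp : p.1 ≠ 0) :
    (poleBallInversion p).1 0 = p.1 0 / ‖p.1‖ ^ 2 - 1 := by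
  change (halfSpaceFold ((‖p.1‖ ^ 2)⁻¹ • p.1 - firstVec n)).1 0 = _
  rw [halfSpaceFold_val (poleBall_inv_nonneg p.2 hp)]
  simp [firstVec_zero, inv_mul_eq_div]

variable {X : Type*} [TopologicalSpace X]

open Classical in
/-- The chart of `X ≃ₜ poleBall n` around a given point. -/
noncomputable def poleBallChart (e : X ≃ₜ poleBall n) (x : X) :
    OpenPartialHomeomorph X (EuclideanHalfSpace n) :=
  -- The inversion misses only the origin; the flip moves that point to the opposite pole e, where
  -- the inversion is defined.
  if (e x).1 = 0 then (e.trans poleBallFlip).transOpenPartialHomeomorph poleBallInversion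
  else e.transOpenPartialHomeomorph poleBallInversion

/-- The structure of a manifold with boundary on a space homeomorphic to `poleBall`. -/
@[reducible]
noncomputable def poleBallChartedSpace (e : X ≃ₜ poleBall n) :
    ChartedSpace (EuclideanHalfSpace n) X where
  atlas := range (poleBallChart e)
  chartAt := poleBallChart e
  mem_chart_source x := by
    unfold poleBallChart
    split_ifs with h
    · have : (poleBallFlip (e x)).1 = firstVec n := by
        change firstVec n - (e x).1 = _
        rw [h, sub_zero]
      have h1 : firstVec n ≠ 0 := fun h0 => by
        have := norm_firstVec (n := n)
        rw [h0] at this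
        norm_num at this
      simp [poleBallInversion, this, h1]
    · simp [poleBallInversion, h]
  chart_mem_atlas := mem_range_self

/-- In the inversion chart the first coordinate is p₀ / ‖p‖² − 1, which is positive exactly off the
bounding sphere. At the origin the flipped chart takes a value on the boundary hyperplane. -/
theorem isInteriorPoint_poleBallChartedSpace (e : X ≃ₜ poleBall n) (x : X) :
    letI := poleBallChartedSpace e
    (𝓡∂ n).IsInteriorPoint x ↔ ‖(e x).1‖ ^ 2 < (e x).1 0 := by
  let := poleBallChartedSpace e
  have h1 : (𝓡∂ n).IsInteriorPoint x ↔ 0 < (poleBallChart e x x).1 0 := by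
    rw [ModelWithCorners.IsInteriorPoint, interior_range_modelWithCornersEuclideanHalfSpace]
    rfl
  rw [h1]
  unfold poleBallChart
  split_ifs with h
  · have h2 : (poleBallFlip (e x)).1 = firstVec n := by
      change firstVec n - (e x).1 = _
      rw [h, sub_zero]
    have h3 : (poleBallFlip (e x)).1 ≠ 0 := fun h0 => by
      have := norm_firstVec (n := n)
      rw [← h2, h0] at this
      norm_num at this
    have h4 := poleBallInversion_zero h3
    change 0 < (poleBallInversion (poleBallFlip (e x))).1 0 ↔ _
    rw [h4, h2, h]
    simp [firstVec_zero, norm_firstVec]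
  · change 0 < (poleBallInversion (e x)).1 0 ↔ _
    have : 0 < ‖(e x).1‖ ^ 2 := by positivity
    rw [poleBallInversion_zero h, sub_pos, one_lt_div this]

end PoleBall

/-! ### The rough function -/

/-- The triangle wave: the distance to the nearest integer. -/
noncomputable def triangleWave (x : ℝ) : ℝ := ‖(x : UnitAddCircle)‖

theorem triangleWave_eq (x : ℝ) : triangleWave x = |x - round x| := UnitAddCircle.norm_eq

theorem triangleWave_nonneg (x : ℝ) : 0 ≤ triangleWave x := norm_nonneg _

theorem triangleWave_le (x : ℝ) : triangleWave x ≤ 1 / 2 := by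
  rw [triangleWave_eq]; exact abs_sub_round x

theorem triangleWave_sub_le (x y : ℝ) : |triangleWave x - triangleWave y| ≤ |x - y| := by
  refine (abs_norm_sub_norm_le _ _).trans ?_
  rw [← AddCircle.coe_sub, UnitAddCircle.norm_eq]
  simpa using round_le (x - y) 0

theorem continuous_triangleWave : Continuous triangleWave :=
  continuous_norm.comp (AddCircle.continuous_mk' 1)

theorem triangleWave_intCast (m : ℤ) : triangleWave m = 0 := by
  simp [triangleWave_eq]

theorem triangleWave_intCast_add_half (m : ℤ) : triangleWave (m + 1 / 2) = 1 / 2 := by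
  have h : round ((m : ℝ) + 1 / 2) = m + 1 := by
    rw [round_eq, add_assoc, add_halves]
    simp
  rw [triangleWave_eq, h]
  push_cast
  rw [show (m : ℝ) + 1 / 2 - (m + 1) = -(1 / 2) by ring, abs_neg]
  norm_num

/-- A nowhere Lipschitz function in the style of Takagi and Weierstrass. -/
noncomputable def roughFun (x : ℝ) : ℝ := ∑' k : ℕ, (1 / 2 : ℝ) ^ k * triangleWave (6 ^ k * x)

theorem roughFun_term_le (k : ℕ) (x : ℝ) :
    ‖(1 / 2 : ℝ) ^ k * triangleWave (6 ^ k * x)‖ ≤ (1 / 2 : ℝ) ^ k * (1 / 2) := by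
  rw [norm_mul, Real.norm_of_nonneg (by positivity),
    Real.norm_of_nonneg (triangleWave_nonneg _)]
  gcongr
  exact triangleWave_le _

theorem summable_roughFun_bound : Summable fun k : ℕ => (1 / 2 : ℝ) ^ k * (1 / 2) :=
  summable_geometric_two.mul_right _

theorem summable_roughFun (x : ℝ) :
    Summable fun k : ℕ => (1 / 2 : ℝ) ^ k * triangleWave (6 ^ k * x) :=
  summable_roughFun_bound.of_norm_bounded fun k => roughFun_term_le k x

theorem continuous_roughFun : Continuous roughFun :=
  continuous_tsum (fun _ => continuous_const.mul
    (continuous_triangleWave.comp (continuous_const.mul continuous_id)))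
    summable_roughFun_bound roughFun_term_le

theorem abs_roughFun_le (x : ℝ) : |roughFun x| ≤ 1 := by
  have h := tsum_of_norm_bounded summable_roughFun_bound.hasSum fun k => roughFun_term_le k x
  rw [tsum_mul_right, tsum_geometric_two] at h
  simpa [roughFun] using h

theorem roughFun_intCast (m : ℤ) : roughFun m = 0 := by
  have : ∀ k : ℕ, (1 / 2 : ℝ) ^ k * triangleWave (6 ^ k * (m : ℝ)) = 0 := fun k => by
    rw [show (6 : ℝ) ^ k * m = ((6 ^ k * m : ℤ) : ℝ) by push_cast; ring, triangleWave_intCast,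
      mul_zero]
  rw [roughFun, tsum_congr this, tsum_zero]

theorem triangleWave_six_pow_mul (N k : ℕ) (m : ℤ) :
    triangleWave (6 ^ (k + N) * (m / 6 ^ N)) = 0 := by
  rw [show (6 : ℝ) ^ (k + N) * (m / 6 ^ N) = ((6 ^ k * m : ℤ) : ℝ) by
    rw [pow_add]; push_cast; field_simp, triangleWave_intCast]

theorem triangleWave_six_pow_mul_half (N k : ℕ) (m : ℤ) :
    triangleWave (6 ^ (k + 1 + N) * ((m + 1 / 2) / 6 ^ N)) = 0 := by
  rw [show (6 : ℝ) ^ (k + 1 + N) * ((m + 1 / 2) / 6 ^ N) = ((6 ^ k * (6 * m + 3) : ℤ) : ℝ) by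
    rw [pow_add, pow_succ]; push_cast; field_simp; ring, triangleWave_intCast]

/-- The oscillation of `roughFun` on a cell of length `6⁻ᴺ`. -/
theorem roughFun_oscillation (N : ℕ) (m : ℤ) :
    (1 / 2 : ℝ) ^ N / 4 ≤ roughFun ((m + 1 / 2) / 6 ^ N) - roughFun (m / 6 ^ N) := by
  set a : ℝ := m / 6 ^ N with ha
  set b : ℝ := (m + 1 / 2) / 6 ^ N with hb
  have h6 : (0 : ℝ) < 6 ^ N := by positivity
  -- At a the terms with k ≥ N vanish. At b those with k > N vanish, because 6 is even, while the
  -- term k = N is half of 2^(-N).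
  have hA : roughFun a = ∑ k ∈ Finset.range N, (1 / 2 : ℝ) ^ k * triangleWave (6 ^ k * a) := by
    rw [roughFun, ← (summable_roughFun a).sum_add_tsum_nat_add N]
    simp only [ha, triangleWave_six_pow_mul, mul_zero, tsum_zero, add_zero]
  have hB : roughFun b = ∑ k ∈ Finset.range N, (1 / 2 : ℝ) ^ k * triangleWave (6 ^ k * b)
      + (1 / 2) ^ N * (1 / 2) := by
    rw [roughFun, ← (summable_roughFun b).sum_add_tsum_nat_add (N + 1), Finset.sum_range_succ]
    have h1 : ∀ k, triangleWave (6 ^ (k + (N + 1)) * b) = 0 := fun k => by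
      rw [show k + (N + 1) = k + 1 + N by ring, hb, triangleWave_six_pow_mul_half]
    have h2 : (6 : ℝ) ^ N * b = m + 1 / 2 := by rw [hb]; field_simp
    simp only [h1, mul_zero, tsum_zero, add_zero, h2, triangleWave_intCast_add_half]
  have hab : b - a = 1 / 2 / 6 ^ N := by rw [ha, hb]; ring
  -- The term k is Lipschitz with constant 3^k. Over the distance 6^(-N) / 2 the terms below N lose
  -- at most a quarter of 2^(-N) together, which leaves a quarter of the gain.
  have hd : ∀ k ∈ Finset.range N, -((3 : ℝ) ^ k * (1 / 2 / 6 ^ N)) ≤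
      (1 / 2 : ℝ) ^ k * triangleWave (6 ^ k * b) - (1 / 2 : ℝ) ^ k * triangleWave (6 ^ k * a) := by
    intro k _
    have h := (abs_le.1 (triangleWave_sub_le (6 ^ k * b) (6 ^ k * a))).1
    rw [← mul_sub, hab, abs_of_nonneg (by positivity)] at h
    have h3 : (3 : ℝ) ^ k = (1 / 2) ^ k * 6 ^ k := by rw [← mul_pow]; norm_num
    rw [← mul_sub, h3, mul_assoc, ← mul_neg]
    gcongr
  have hs := Finset.sum_le_sum hd
  rw [Finset.sum_sub_distrib, Finset.sum_neg_distrib, ← Finset.sum_mul,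
    geom_sum_eq (by norm_num)] at hs
  have h2 : (1 / 2 : ℝ) ^ N = 3 ^ N / 6 ^ N := by rw [← div_pow]; norm_num
  have h4 : ((3 : ℝ) ^ N - 1) / (3 - 1) * (1 / 2 / 6 ^ N) ≤ (1 / 2 : ℝ) ^ N / 4 := by
    rw [h2, div_mul_div_comm, div_div]
    rw [div_le_div_iff₀ (by positivity) (by positivity)]
    nlinarith
  rw [hA, hB]
  linarith

/-! ### Smooth paths and their lengths -/

section Paths

variable {n : ℕ}

/-- `a` and `b` are joined in `U` by a smooth path of length at most `L` that is constant near both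
ends. -/
def JoinedSmoothly (U : Set (EuclideanSpace ℝ (Fin n))) (L : ℝ≥0∞)
    (a b : EuclideanSpace ℝ (Fin n)) : Prop :=
  ∃ γ : ℝ → EuclideanSpace ℝ (Fin n), ContDiff ℝ ∞ γ ∧ (∀ t ≤ 0, γ t = a) ∧
    (∀ t, 1 ≤ t → γ t = b) ∧ (∀ t, γ t ∈ U) ∧ eVariationOn γ (Icc 0 1) ≤ L

theorem eVariationOn_Icc_lt_top {E : Type*} [NormedAddCommGroup E] [NormedSpace ℝ E] {κ : ℝ → E}
    (hκ : ContDiff ℝ ∞ κ) : eVariationOn κ (Icc 0 1) < ⊤ := by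
  obtain ⟨C, hC⟩ := hκ.contDiffOn.exists_lipschitzOnWith
    (s := Icc (0 : ℝ) 1) (by simp) (convex_Icc 0 1) isCompact_Icc
  have h := hC.locallyBoundedVariationOn 0 1 (by simp) (by simp)
  rw [inter_self] at h
  exact h.lt_top

theorem eVariationOn_segment_le {E : Type*} [NormedAddCommGroup E] [NormedSpace ℝ E] (a : E) :
    eVariationOn (fun t : ℝ => t • a) (Icc 0 1) ≤ ENNReal.ofReal ‖a‖ := by
  have h : LipschitzOnWith ‖a‖₊ (fun t : ℝ => t • a) (Icc 0 1) := by
    refine LipschitzOnWith.of_dist_le_mul fun x _ y _ => ?_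
    rw [dist_eq_norm, ← sub_smul, norm_smul, mul_comm, Real.dist_eq]
    rfl
  refine (h.comp_eVariationOn_le (g := id) (s := Icc 0 1) fun x hx => hx).trans ?_
  have h2 := (monotoneOn_id (s := Icc (0 : ℝ) 1)).eVariationOn_eq
    (a := 0) (b := 1) (by simp) (by simp)
  rw [inter_self] at h2
  calc _ ≤ (‖a‖₊ : ℝ≥0∞) * ENNReal.ofReal (id 1 - id 0) := by rw [h2]
    _ = ENNReal.ofReal ‖a‖ := by simp [ofReal_norm, enorm_eq_nnnorm]

theorem joinedSmoothly_of_curve {U : Set (EuclideanSpace ℝ (Fin n))}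
    {κ : ℝ → EuclideanSpace ℝ (Fin n)} (hκ : ContDiff ℝ ∞ κ) {a b : ℝ} (ha : a ∈ Icc (0 : ℝ) 1)
    (hb : b ∈ Icc (0 : ℝ) 1) (hU : ∀ t ∈ uIcc a b, κ t ∈ U) :
    JoinedSmoothly U (eVariationOn κ (Icc 0 1)) (κ a) (κ b) := by
  -- A monotone or antitone reparametrization that is constant outside [0, 1]; it does not increase
  -- the variation.
  set φ : ℝ → ℝ := fun t => a + Real.smoothTransition t * (b - a) with hφ
  have hmem : ∀ t, φ t ∈ uIcc a b := fun t => by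
    have h0 := Real.smoothTransition.nonneg t
    have h1 := Real.smoothTransition.le_one t
    have := (convex_uIcc a b) left_mem_uIcc right_mem_uIcc (sub_nonneg.2 h1) h0 (by ring)
    convert this using 1
    simp only [hφ, smul_eq_mul]; ring
  have hmaps : MapsTo φ (Icc 0 1) (Icc 0 1) := fun t _ => by
    have h := hmem t
    have h2 : uIcc a b ⊆ Icc 0 1 := (convex_Icc (0 : ℝ) 1).ordConnected.uIcc_subset ha hb
    exact h2 h
  refine ⟨κ ∘ φ, hκ.comp ?_, fun t ht => ?_, fun t ht => ?_, fun t => hU _ (hmem t), ?_⟩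
  · exact contDiff_const.add (Real.smoothTransition.contDiff.mul contDiff_const)
  · simp [hφ, Real.smoothTransition.zero_of_nonpos ht]
  · simp [hφ, Real.smoothTransition.one_of_one_le ht]
  · rcases le_total a b with hab | hab
    · refine eVariationOn.comp_le_of_monotoneOn _ _ (fun s _ t _ hst => ?_) hmaps
      have := Real.smoothTransition.monotone hst
      have := mul_le_mul_of_nonneg_right this (sub_nonneg.2 hab)
      simp only [hφ]; linarith
    · refine eVariationOn.comp_le_of_antitoneOn _ _ (fun s _ t _ hst => ?_) hmaps
      have := Real.smoothTransition.monotone hst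
      have := mul_le_mul_of_nonneg_right this (sub_nonneg.2 hab)
      simp only [hφ]; linarith

/-- Two smooth paths of `JoinedSmoothly` can be concatenated. -/
theorem exists_smooth_concat {U : Set (EuclideanSpace ℝ (Fin n))} {L₁ L₂ : ℝ≥0∞}
    {a b c : EuclideanSpace ℝ (Fin n)} (h₁ : JoinedSmoothly U L₁ a b)
    (h₂ : JoinedSmoothly U L₂ b c) :
    ∃ γ : ℝ → EuclideanSpace ℝ (Fin n), ContDiff ℝ ∞ γ ∧ (∀ t ≤ 0, γ t = a) ∧
    (∀ t, 1 ≤ t → γ t = c) ∧ (∀ t, γ t ∈ U) ∧ eVariationOn γ (Icc 0 1) ≤ L₁ + L₂ ∧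
    γ (1 / 2) = b := by
  obtain ⟨γ, hγ, hγ0, hγ1, hγU, hγL⟩ := h₁
  obtain ⟨δ, hδ, hδ0, hδ1, hδU, hδL⟩ := h₂
  -- On each half one of the two summands is constantly b, so the sum is the concatenation, and its
  -- smoothness needs no gluing argument.
  set η : ℝ → EuclideanSpace ℝ (Fin n) := fun t => γ (2 * t) + δ (2 * t - 1) - b with hη
  have hl : ∀ t ≤ 1 / 2, η t = γ (2 * t) := fun t ht => by
    simp [hη, hδ0 (2 * t - 1) (by linarith)]
  have hr : ∀ t, 1 / 2 ≤ t → η t = δ (2 * t - 1) := fun t ht => by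
    simp [hη, hγ1 (2 * t) (by linarith)]
  refine ⟨η, ?_, fun t ht => ?_, fun t ht => ?_, fun t => ?_, ?_, ?_⟩
  · exact ((hγ.comp (contDiff_const.mul contDiff_id)).add
      (hδ.comp ((contDiff_const.mul contDiff_id).sub contDiff_const))).sub contDiff_const
  · rw [hl t (by linarith), hγ0 _ (by linarith)]
  · rw [hr t (by linarith), hδ1 _ (by linarith)]
  · rcases le_total t (1 / 2) with h | h
    · rw [hl t h]; exact hγU _
    · rw [hr t h]; exact hδU _
  · have h := eVariationOn.Icc_add_Icc η (s := univ) (a := 0) (b := 1 / 2) (c := 1)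
      (by norm_num) (by norm_num) (mem_univ _)
    simp only [univ_inter] at h
    rw [← h]
    gcongr
    · refine le_trans ?_ hγL
      rw [eVariationOn.congr (g := γ ∘ fun t => 2 * t) fun t ht => hl t ht.2]
      refine eVariationOn.comp_le_of_monotoneOn _ _ (fun s _ t _ hst => ?_) fun t ht => ?_
      · simpa using hst
      · constructor <;> linarith [ht.1, ht.2]
    · refine le_trans ?_ hδL
      rw [eVariationOn.congr (g := δ ∘ fun t => 2 * t - 1) fun t ht => hr t ht.1]
      refine eVariationOn.comp_le_of_monotoneOn _ _ (fun s _ t _ hst => ?_) fun t ht => ?_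
      · simpa using hst
      · constructor <;> linarith [ht.1, ht.2]
  · rw [hl _ le_rfl, hγ1 _ (by norm_num)]

theorem JoinedSmoothly.trans {U : Set (EuclideanSpace ℝ (Fin n))} {L₁ L₂ : ℝ≥0∞}
    {a b c : EuclideanSpace ℝ (Fin n)} (h₁ : JoinedSmoothly U L₁ a b)
    (h₂ : JoinedSmoothly U L₂ b c) : JoinedSmoothly U (L₁ + L₂) a c := by
  obtain ⟨γ, h1, h2, h3, h4, h5, -⟩ := exists_smooth_concat h₁ h₂
  exact ⟨γ, h1, h2, h3, h4, h5⟩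

theorem JoinedSmoothly.symm {U : Set (EuclideanSpace ℝ (Fin n))} {L : ℝ≥0∞}
    {a b : EuclideanSpace ℝ (Fin n)} (h : JoinedSmoothly U L a b) : JoinedSmoothly U L b a := by
  obtain ⟨γ, h1, h2, h3, h4, h5⟩ := h
  refine ⟨γ ∘ fun t => 1 - t, h1.comp (contDiff_const.sub contDiff_id), fun t ht => ?_,
    fun t ht => ?_, fun t => h4 _, le_trans ?_ h5⟩
  · exact h3 _ (by linarith)
  · exact h2 _ (by linarith)
  · refine eVariationOn.comp_le_of_antitoneOn _ _ (fun s _ t _ hst => ?_) fun t ht => ?_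
    · linarith
    · constructor <;> linarith [ht.1, ht.2]

theorem JoinedSmoothly.pathInfLength_le {U : Set (EuclideanSpace ℝ (Fin n))} {L : ℝ≥0∞}
    {a b : EuclideanSpace ℝ (Fin n)} (h : JoinedSmoothly U L a b) (hab : a ≠ b) :
    pathInfLength U a b ≤ L := by
  obtain ⟨γ, h1, h2, h3, h4, h5⟩ := h
  refine (iInf₂_le γ ⟨h1.contDiffOn, fun t _ => h4 t, h2 0 le_rfl, h3 1 le_rfl, 1, by simp, ?_⟩).trans
    h5
  rw [h2 0 le_rfl, h3 1 le_rfl]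
  exact hab.symm

/-- The ends a and c may coincide: the concatenation passes through b ≠ a at time 1/2, so it is
non-constant anyway. -/
theorem JoinedSmoothly.pathInfLength_trans_le {U : Set (EuclideanSpace ℝ (Fin n))}
    {L₁ L₂ : ℝ≥0∞} {a b c : EuclideanSpace ℝ (Fin n)} (h₁ : JoinedSmoothly U L₁ a b)
    (h₂ : JoinedSmoothly U L₂ b c) (hab : a ≠ b) : pathInfLength U a c ≤ L₁ + L₂ := by
  obtain ⟨γ, h1, h2, h3, h4, h5, h6⟩ := exists_smooth_concat h₁ h₂
  refine (iInf₂_le γ ⟨h1.contDiffOn, fun t _ => h4 t, h2 0 le_rfl, h3 1 le_rfl, 1 / 2,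
    by norm_num, ?_⟩).trans h5
  rw [h2 0 le_rfl, h6]
  exact hab.symm

/-- Any two points of a connected open set are joined by a smooth path of finite length. -/
theorem exists_joinedSmoothly {U : Set (EuclideanSpace ℝ (Fin n))} (hU : IsOpen U)
    (hc : IsPreconnected U) {a b : EuclideanSpace ℝ (Fin n)} (ha : a ∈ U) (hb : b ∈ U) :
    ∃ L < ⊤, JoinedSmoothly U L a b := by
  refine hc.induction₂ (fun a b => ∃ L < ⊤, JoinedSmoothly U L a b) ?_ ?_ ?_ ha hb
  · intro x hx
    obtain ⟨r, hr, hrU⟩ := Metric.isOpen_iff.1 hU x hx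
    filter_upwards [nhdsWithin_le_nhds (Metric.ball_mem_nhds x hr)] with y hy
    have hκ : ContDiff ℝ ∞ (fun t : ℝ => x + t • (y - x)) :=
      contDiff_const.add (contDiff_id.smul contDiff_const)
    refine ⟨_, eVariationOn_Icc_lt_top hκ, ?_⟩
    have := joinedSmoothly_of_curve (U := U) hκ (a := 0) (b := 1) (by simp) (by simp)
      fun t ht => hrU ?_
    · simpa using this
    · rw [uIcc_of_le zero_le_one] at ht
      exact (convex_ball x r).add_smul_sub_mem (Metric.mem_ball_self hr) hy ht
  · rintro x y z - - - ⟨L, hL, h⟩ ⟨L', hL', h'⟩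
    exact ⟨_, ENNReal.add_lt_top.2 ⟨hL, hL'⟩, h.trans h'⟩
  · rintro x y - - ⟨L, hL, h⟩
    exact ⟨L, hL, h.symm⟩

/-- A function is controlled by the length of a path if this holds in steps, up to an error at the
end. -/
theorem ofReal_abs_sub_le_eVariationOn {E : Type*} [PseudoEMetricSpace E] {f : ℝ → ℝ} {γ : ℝ → E}
    {ε : ℝ} (hf : ContinuousOn f (Icc 0 1))
    (h : ∀ t ∈ Icc (0 : ℝ) 1, (∃ t' ∈ Ioc t 1,
        ENNReal.ofReal |f t' - f t| ≤ eVariationOn γ (Icc t t')) ∨ |f 1 - f t| ≤ ε) :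
    ENNReal.ofReal (|f 1 - f 0| - ε) ≤ eVariationOn γ (Icc 0 1) := by
  -- Continuous induction: the supremum of S lies in S, by continuity of f and monotonicity of the
  -- variation. A step beyond it would contradict maximality, so the alternative with error ε must
  -- hold there.
  set S : Set ℝ := {t ∈ Icc (0 : ℝ) 1 | ENNReal.ofReal |f t - f 0| ≤ eVariationOn γ (Icc 0 t)}
    with hS
  have h0 : (0 : ℝ) ∈ S := ⟨by simp, by simp⟩
  have hbdd : BddAbove S := ⟨1, fun t ht => ht.1.2⟩
  have hT0 : 0 ≤ sSup S := le_csSup hbdd h0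
  have hT1 : sSup S ≤ 1 := csSup_le ⟨0, h0⟩ fun t ht => ht.1.2
  have hTS : sSup S ∈ S := by
    refine ⟨⟨hT0, hT1⟩, ?_⟩
    have hcl : sSup S ∈ closure S := csSup_mem_closure ⟨0, h0⟩ hbdd
    have : (𝓝[S] sSup S).NeBot := mem_closure_iff_nhdsWithin_neBot.1 hcl
    have hlim : Tendsto (fun t => ENNReal.ofReal |f t - f 0|) (𝓝[S] sSup S)
        (𝓝 (ENNReal.ofReal |f (sSup S) - f 0|)) := by
      have h1 : Tendsto f (𝓝[S] sSup S) (𝓝 (f (sSup S))) :=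
        (hf _ ⟨hT0, hT1⟩).mono_left (nhdsWithin_mono _ fun t ht => ht.1)
      exact (ENNReal.continuous_ofReal.tendsto _).comp (h1.sub_const _).abs
    refine le_of_tendsto hlim ?_
    filter_upwards [self_mem_nhdsWithin] with t ht
    exact ht.2.trans (eVariationOn.mono _ (Icc_subset_Icc_right (le_csSup hbdd ht)))
  rcases h _ hTS.1 with ⟨t', ht', hv⟩ | hend
  · exfalso
    have ht'S : t' ∈ S := by
      refine ⟨⟨hT0.trans ht'.1.le, ht'.2⟩, ?_⟩
      have hadd := eVariationOn.Icc_add_Icc γ (s := univ) hT0 ht'.1.le (mem_univ _)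
      simp only [univ_inter] at hadd
      rw [← hadd]
      calc ENNReal.ofReal |f t' - f 0|
          ≤ ENNReal.ofReal (|f (sSup S) - f 0| + |f t' - f (sSup S)|) := by
            apply ENNReal.ofReal_le_ofReal
            have := abs_sub_le (f t') (f (sSup S)) (f 0)
            linarith
        _ ≤ _ := ENNReal.ofReal_add_le.trans (add_le_add hTS.2 hv)
    exact absurd (le_csSup hbdd ht'S) (not_le.2 ht'.1)
  · refine le_trans (ENNReal.ofReal_le_ofReal ?_)
      (hTS.2.trans (eVariationOn.mono _ (Icc_subset_Icc_right hT1)))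
    have := abs_sub_le (f 1) (f (sSup S)) (f 0)
    linarith

end Paths

theorem continuous_euclideanSingle {n : ℕ} (j : Fin n) :
    Continuous fun a : ℝ => (EuclideanSpace.single j a : EuclideanSpace ℝ (Fin n)) :=
  (PiLp.continuous_toLp 2 _).comp (continuous_single (A := fun _ : Fin n => ℝ) j)

/-- The filter is not punctured, so a lower limit at a point of U may be tested at the point itself.
-/
theorem frequently_eq_of_mem {X : Type*} [TopologicalSpace X] {U : Set X} {a : X} (ha : a ∈ U) :
    ∃ᶠ q in 𝓝[U] a, q = a := fun h =>
  eventually_pure.1 (h.filter_mono (pure_le_nhdsWithin ha)) rfl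

/-! ### The sheared ball and its cheap radial paths -/

section Shear

variable {n : ℕ} [NeZero n]

/-- The map that replaces the coordinate `j` of `p` by `p₀² pⱼ / 60000 + p₀ w(pᵢ / p₀)`, where `w`
is the rough function. -/
noncomputable def roughShear (i j : Fin n) (p : EuclideanSpace ℝ (Fin n)) :
    EuclideanSpace ℝ (Fin n) :=
  p + EuclideanSpace.single j (p 0 ^ 2 / 60000 * p j - p j + p 0 * roughFun (p i / p 0))

/-- The inverse of `roughShear` on the half-space `0 < p 0`. -/
noncomputable def roughUnshear (i j : Fin n) (q : EuclideanSpace ℝ (Fin n)) :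
    EuclideanSpace ℝ (Fin n) :=
  q + EuclideanSpace.single j ((q j - q 0 * roughFun (q i / q 0)) / (q 0 ^ 2 / 60000) - q j)

/-- The interior of `poleBall`. -/
def openPoleBall (n : ℕ) [NeZero n] : Set (EuclideanSpace ℝ (Fin n)) := {p | ‖p‖ ^ 2 < p 0}

theorem openPoleBall_eq_ball :
    openPoleBall n = Metric.ball ((1 / 2 : ℝ) • firstVec n) (1 / 2) := by
  ext p
  have h : ‖p - (1 / 2 : ℝ) • firstVec n‖ ^ 2 = ‖p‖ ^ 2 - p 0 + 1 / 4 := by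
    rw [norm_sub_sq_real, inner_smul_right, inner_firstVec, norm_smul, norm_firstVec]
    norm_num
    ring
  rw [mem_ball_iff_norm, ← sq_lt_sq₀ (norm_nonneg _) (by norm_num), h]
  change ‖p‖ ^ 2 < p 0 ↔ _
  constructor <;> intro h <;> linarith

theorem openPoleBall_subset : openPoleBall n ⊆ poleBall n := fun p hp => le_of_lt (α := ℝ) (a := ‖p‖ ^ 2) hp

theorem pos_of_mem_openPoleBall {p : EuclideanSpace ℝ (Fin n)} (hp : p ∈ openPoleBall n) :
    0 < p 0 := (sq_nonneg ‖p‖).trans_lt hp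

theorem pos_of_mem_poleBall {p : EuclideanSpace ℝ (Fin n)} (hp : p ∈ poleBall n) (h0 : p ≠ 0) :
    0 < p 0 := (pow_pos (norm_pos_iff.2 h0) 2).trans_le hp

theorem norm_lt_one_of_mem_openPoleBall {p : EuclideanSpace ℝ (Fin n)}
    (hp : p ∈ openPoleBall n) : ‖p‖ < 1 := by
  have h1 : ‖p‖ ^ 2 < p 0 := hp
  have h2 : p 0 ≤ ‖p‖ := (le_abs_self _).trans (PiLp.norm_apply_le p 0)
  nlinarith [norm_nonneg p]

theorem smul_mem_openPoleBall {p : EuclideanSpace ℝ (Fin n)} (hp : p ∈ poleBall n) (h0 : p ≠ 0)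
    {t : ℝ} (ht0 : 0 < t) (ht1 : t < 1) : t • p ∈ openPoleBall n := by
  have h1 : ‖p‖ ^ 2 ≤ p 0 := hp
  have h2 := pos_of_mem_poleBall hp h0
  change ‖t • p‖ ^ 2 < (t • p) 0
  rw [norm_smul, mul_pow, Real.norm_of_nonneg ht0.le, PiLp.smul_apply, smul_eq_mul]
  calc t ^ 2 * ‖p‖ ^ 2 ≤ t ^ 2 * p 0 := by gcongr
    _ = t * (t * p 0) := by ring
    _ < 1 * (t * p 0) := by gcongr
    _ = t * p 0 := one_mul _

variable {i j : Fin n}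

theorem roughShear_apply_of_ne {k : Fin n} (hk : k ≠ j) (p : EuclideanSpace ℝ (Fin n)) :
    roughShear i j p k = p k := by
  simp [roughShear, hk]

theorem roughShear_apply_self (p : EuclideanSpace ℝ (Fin n)) :
    roughShear i j p j = p 0 ^ 2 / 60000 * p j + p 0 * roughFun (p i / p 0) := by
  simp only [roughShear, PiLp.add_apply, PiLp.single_apply, if_true]; ring

theorem roughShear_zero : roughShear i j (0 : EuclideanSpace ℝ (Fin n)) = 0 := by
  simp [roughShear]

theorem roughUnshear_roughShear (hj : 0 ≠ j) (hij : i ≠ j) {p : EuclideanSpace ℝ (Fin n)}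
    (hp : p 0 ≠ 0) : roughUnshear i j (roughShear i j p) = p := by
  rw [roughUnshear, roughShear_apply_self, roughShear_apply_of_ne hj, roughShear_apply_of_ne hij]
  ext k
  rcases eq_or_ne k j with rfl | hk
  · simp only [PiLp.add_apply, PiLp.single_apply, if_true, roughShear_apply_self]
    field_simp
    ring
  · simp [hk, roughShear_apply_of_ne hk]

theorem roughShear_roughUnshear (hj : 0 ≠ j) (hij : i ≠ j) {q : EuclideanSpace ℝ (Fin n)}
    (hq : q 0 ≠ 0) : roughShear i j (roughUnshear i j q) = q := by
  have h (k : Fin n) (hk : k ≠ j) : roughUnshear i j q k = q k := by simp [roughUnshear, hk]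
  ext k
  rcases eq_or_ne k j with rfl | hk
  · rw [roughShear_apply_self, h _ hj, h _ hij]
    simp only [roughUnshear, PiLp.add_apply, PiLp.single_apply, if_true]
    field_simp
    ring
  · rw [roughShear_apply_of_ne hk, h _ hk]

/-- Where p₀ = 0 the slope is meaningless, but the rough function is bounded and the factor p₀ tends
to 0. -/
theorem continuous_coord_mul_roughFun :
    Continuous fun p : EuclideanSpace ℝ (Fin n) => p 0 * roughFun (p i / p 0) := by
  rw [continuous_iff_continuousAt]
  intro p
  by_cases h0 : p 0 = 0
  · have hlim : Tendsto (fun p : EuclideanSpace ℝ (Fin n) => |p 0|) (𝓝 p) (𝓝 0) := by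
      have : Continuous fun p : EuclideanSpace ℝ (Fin n) => |p 0| := by fun_prop
      have := this.tendsto p
      rwa [h0, abs_zero] at this
    rw [ContinuousAt, h0, zero_mul]
    refine squeeze_zero_norm (fun q => ?_) hlim
    rw [norm_mul]
    exact mul_le_of_le_one_right (abs_nonneg _) (abs_roughFun_le _)
  · have h1 : ContinuousAt (fun p : EuclideanSpace ℝ (Fin n) => p i / p 0) p :=
      ContinuousAt.div (by fun_prop) (by fun_prop) h0
    exact ContinuousAt.mul (by fun_prop) (continuous_roughFun.continuousAt.comp h1)

theorem continuous_roughShear : Continuous (roughShear i j : EuclideanSpace ℝ (Fin n) → _) :=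
  have h : Continuous fun p : EuclideanSpace ℝ (Fin n) => p 0 ^ 2 / 60000 * p j - p j := by
    fun_prop
  continuous_id.add ((continuous_euclideanSingle j).comp (h.add continuous_coord_mul_roughFun))

theorem continuousOn_roughUnshear :
    ContinuousOn (roughUnshear i j) {q : EuclideanSpace ℝ (Fin n) | 0 < q 0} := by
  have h1 : Continuous fun q : EuclideanSpace ℝ (Fin n) => q j := by fun_prop
  have h2 : Continuous fun q : EuclideanSpace ℝ (Fin n) => q 0 ^ 2 / 60000 := by fun_prop
  refine continuousOn_id.add ((continuous_euclideanSingle j).comp_continuousOn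
    (((h1.sub continuous_coord_mul_roughFun).continuousOn.div h2.continuousOn fun q hq => ?_).sub
      h1.continuousOn))
  have : 0 < q 0 := hq
  positivity

theorem injOn_roughShear (hj : 0 ≠ j) (hij : i ≠ j) : InjOn (roughShear i j) (poleBall n) := by
  intro p hp q hq h
  have h0 : p 0 = q 0 := by
    rw [← roughShear_apply_of_ne (i := i) hj p, h, roughShear_apply_of_ne hj]
  by_cases hp0 : p = 0
  · by_contra hne
    have := pos_of_mem_poleBall hq fun h => hne (hp0.trans h.symm)
    rw [← h0, hp0] at this
    exact lt_irrefl _ this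
  · have h1 := (pos_of_mem_poleBall hp hp0).ne'
    rw [← roughUnshear_roughShear hj hij h1, h, roughUnshear_roughShear hj hij (h0 ▸ h1)]

/-- The manifold: a closed ball, sheared roughly. -/
def roughBall (i j : Fin n) : Set (EuclideanSpace ℝ (Fin n)) := roughShear i j '' poleBall n

/-- The interior of the manifold. -/
def roughInterior (i j : Fin n) : Set (EuclideanSpace ℝ (Fin n)) :=
  roughShear i j '' openPoleBall n

theorem isCompact_poleBall : IsCompact (poleBall n) := by
  rw [isCompact_iff_compactSpace]
  exact closedBallHomeoPoleBall.compactSpace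

/-- The homeomorphism of the manifold with the closed ball. -/
noncomputable def roughBallHomeo (hj : 0 ≠ j) (hij : i ≠ j) : roughBall i j ≃ₜ poleBall n :=
  haveI : CompactSpace (poleBall n) := isCompact_iff_compactSpace.1 isCompact_poleBall
  have h : Continuous (Equiv.Set.imageOfInjOn (roughShear i j) (poleBall n)
      (injOn_roughShear hj hij)) :=
    Continuous.subtype_mk (f := fun p : poleBall n => roughShear i j p.1)
      (continuous_roughShear.comp continuous_subtype_val) fun p => mem_image_of_mem _ p.2
  h.homeoOfEquivCompactToT2.symm

theorem roughShear_roughBallHomeo (hj : 0 ≠ j) (hij : i ≠ j) (y : roughBall i j) :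
    roughShear i j (roughBallHomeo hj hij y) = y :=
  congrArg Subtype.val ((roughBallHomeo hj hij).symm_apply_apply y)

theorem manifoldInt_roughBall (hj : 0 ≠ j) (hij : i ≠ j) :
    letI := poleBallChartedSpace (roughBallHomeo hj hij)
    manifoldInt (roughBall i j) = roughInterior i j := by
  let := poleBallChartedSpace (roughBallHomeo hj hij)
  ext q
  constructor
  · rintro ⟨y, hy, rfl⟩
    exact ⟨_, (isInteriorPoint_poleBallChartedSpace _ y).1 hy, roughShear_roughBallHomeo hj hij y⟩
  · rintro ⟨p, hp, rfl⟩
    have hpB := openPoleBall_subset hp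
    refine ⟨⟨roughShear i j p, mem_image_of_mem _ hpB⟩,
      (isInteriorPoint_poleBallChartedSpace _ _).2 ?_, rfl⟩
    have : (roughBallHomeo hj hij ⟨roughShear i j p, mem_image_of_mem _ hpB⟩).1 = p :=
      injOn_roughShear hj hij (Subtype.property _) hpB (roughShear_roughBallHomeo hj hij _)
    rwa [this]

theorem zero_mem_manifoldBdry_roughBall (hj : 0 ≠ j) (hij : i ≠ j) :
    letI := poleBallChartedSpace (roughBallHomeo hj hij)
    (0 : EuclideanSpace ℝ (Fin n)) ∈ manifoldBdry (roughBall i j) := by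
  let := poleBallChartedSpace (roughBallHomeo hj hij)
  have h0 : (0 : EuclideanSpace ℝ (Fin n)) ∈ roughBall i j :=
    ⟨0, zero_mem_poleBall, roughShear_zero⟩
  refine ⟨⟨0, h0⟩, ?_, rfl⟩
  rw [← ModelWithCorners.compl_interior]
  intro hint
  have h : (0 : EuclideanSpace ℝ (Fin n)) ∈ roughInterior i j := by
    rw [← manifoldInt_roughBall hj hij]
    exact ⟨_, hint, rfl⟩
  obtain ⟨p, hp, hp0⟩ := h
  have := pos_of_mem_openPoleBall hp
  rw [← roughShear_apply_of_ne (i := i) hj p, hp0] at this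
  exact lt_irrefl _ this

/-- The explicit inverse is continuous on the open half-space, and the set is a preimage under it;
invariance of domain is not needed. -/
theorem isOpen_roughInterior (hj : 0 ≠ j) (hij : i ≠ j) : IsOpen (roughInterior i j) := by
  have hopen : IsOpen {q : EuclideanSpace ℝ (Fin n) | 0 < q 0} :=
    isOpen_lt continuous_const (by fun_prop)
  have hball : IsOpen (openPoleBall n) := by rw [openPoleBall_eq_ball]; exact Metric.isOpen_ball
  convert (continuousOn_roughUnshear (i := i) (j := j)).isOpen_inter_preimage hopen hball using 1
  ext q
  constructor
  · rintro ⟨p, hp, rfl⟩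
    have h := pos_of_mem_openPoleBall hp
    refine ⟨?_, ?_⟩
    · change 0 < roughShear i j p 0
      rwa [roughShear_apply_of_ne hj]
    · rwa [mem_preimage, roughUnshear_roughShear hj hij h.ne']
  · rintro ⟨h0, hq⟩
    exact ⟨_, hq, roughShear_roughUnshear hj hij (ne_of_gt h0)⟩

theorem isPreconnected_roughInterior : IsPreconnected (roughInterior i j) := by
  have : IsPreconnected (openPoleBall n) := by
    rw [openPoleBall_eq_ball]; exact (convex_ball _ _).isPreconnected
  exact this.image _ continuous_roughShear.continuousOn

theorem isConnected_roughBall : IsConnected (roughBall i j) := by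
  have : IsConnected (poleBall n) := by
    rw [isConnected_iff_connectedSpace]
    have : ConnectedSpace (Metric.closedBall (0 : EuclideanSpace ℝ (Fin n)) 1) :=
      isConnected_iff_connectedSpace.1
        ((convex_closedBall _ _).isConnected ⟨0, by simp⟩)
    exact closedBallHomeoPoleBall.surjective.connectedSpace closedBallHomeoPoleBall.continuous
  exact this.image _ continuous_roughShear.continuousOn

/-- The slope is constant along a ray, so the rough function enters only through a constant and the
curve is polynomial in t. -/
theorem contDiff_roughShear_ray (b : EuclideanSpace ℝ (Fin n)) :
    ContDiff ℝ ∞ fun t : ℝ => roughShear i j (t • b) := by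
  have h : (fun t : ℝ => roughShear i j (t • b)) = fun t : ℝ => t • b +
      ((t * b 0) ^ 2 / 60000 * (t * b j) - t * b j + t * (b 0 * roughFun (b i / b 0))) •
        (EuclideanSpace.single j 1 : EuclideanSpace ℝ (Fin n)) := by
    funext t
    have h1 : t * b 0 * roughFun (t * b i / (t * b 0)) = t * (b 0 * roughFun (b i / b 0)) := by
      rcases eq_or_ne t 0 with rfl | ht
      · simp
      · rw [mul_div_mul_left _ _ ht, mul_assoc]
    ext k
    simp only [roughShear, PiLp.add_apply, PiLp.smul_apply, smul_eq_mul, PiLp.single_apply, h1]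
    split_ifs <;> simp
  rw [h]
  fun_prop

theorem roughShear_ray_mem {b : EuclideanSpace ℝ (Fin n)} (hb : b ∈ poleBall n) (h0 : b ≠ 0)
    {t : ℝ} (ht0 : 0 < t) (ht1 : t < 1) : roughShear i j (t • b) ∈ roughInterior i j :=
  mem_image_of_mem _ (smul_mem_openPoleBall hb h0 ht0 ht1)

theorem joinedSmoothly_ray {b : EuclideanSpace ℝ (Fin n)} (hb : b ∈ poleBall n) (h0 : b ≠ 0)
    {s t : ℝ} (hs : s ∈ Ioo (0 : ℝ) 1) (ht : t ∈ Ioo (0 : ℝ) 1) :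
    JoinedSmoothly (roughInterior i j)
      (eVariationOn (fun t : ℝ => roughShear i j (t • b)) (Icc 0 1))
      (roughShear i j (s • b)) (roughShear i j (t • b)) := by
  refine joinedSmoothly_of_curve (contDiff_roughShear_ray b) (Ioo_subset_Icc_self hs)
    (Ioo_subset_Icc_self ht) fun r hr => ?_
  have h := (convex_Ioo (0 : ℝ) 1).ordConnected.uIcc_subset hs ht hr
  exact roughShear_ray_mem hb h0 h.1 h.2

/-- Every s in [0, 1] is a limit of parameters in (0, 1), where the ray runs in the interior; this
reaches boundary points from inside. The predicate P serves to exclude a parameter value. -/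
theorem frequently_ray {b : EuclideanSpace ℝ (Fin n)} (hb : b ∈ poleBall n) (h0 : b ≠ 0)
    {s : ℝ} (hs : s ∈ Icc (0 : ℝ) 1) {P : ℝ → Prop} (hP : ∀ᶠ t in 𝓝 s, P t) :
    ∃ᶠ q in 𝓝[roughInterior i j] (roughShear i j (s • b)),
      ∃ t ∈ Ioo (0 : ℝ) 1, P t ∧ q = roughShear i j (t • b) := by
  have : (𝓝[Ioo 0 1] s).NeBot := by
    rw [← mem_closure_iff_nhdsWithin_neBot, closure_Ioo zero_ne_one]
    exact hs
  have hlim : Tendsto (fun t : ℝ => roughShear i j (t • b)) (𝓝[Ioo 0 1] s)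
      (𝓝[roughInterior i j] (roughShear i j (s • b))) := by
    refine tendsto_nhdsWithin_iff.2
      ⟨((contDiff_roughShear_ray b).continuous.tendsto s).mono_left nhdsWithin_le_nhds, ?_⟩
    filter_upwards [self_mem_nhdsWithin] with t ht
    exact roughShear_ray_mem hb h0 ht.1 ht.2
  refine hlim.frequently (Eventually.frequently ?_)
  filter_upwards [self_mem_nhdsWithin, nhdsWithin_le_nhds hP] with t ht hPt
  exact ⟨t, ht, hPt, rfl⟩

theorem roughShear_ray_ne (hj : 0 ≠ j) {b : EuclideanSpace ℝ (Fin n)} (hb : b ∈ poleBall n)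
    (h0 : b ≠ 0) {s t : ℝ} (hst : s ≠ t) : roughShear i j (s • b) ≠ roughShear i j (t • b) := by
  intro h
  have h1 := congrArg (fun q : EuclideanSpace ℝ (Fin n) => q 0) h
  simp only [roughShear_apply_of_ne hj, PiLp.smul_apply, smul_eq_mul] at h1
  exact hst (mul_right_cancel₀ (pos_of_mem_poleBall hb h0).ne' h1)

theorem half_firstVec_mem : (1 / 2 : ℝ) • firstVec n ∈ openPoleBall n := by
  rw [openPoleBall_eq_ball]; simp

/-- Every point of the manifold is a limit of interior points that are joined to a fixed interior
point by paths of bounded length. -/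
theorem exists_frequently_joinedSmoothly (hj : 0 ≠ j) {p : EuclideanSpace ℝ (Fin n)}
    (hp : p ∈ roughBall i j) :
    ∃ m ∈ roughInterior i j, ∃ M < ⊤, ∃ᶠ q in 𝓝[roughInterior i j] p,
      q ≠ m ∧ JoinedSmoothly (roughInterior i j) M q m := by
  -- The origin is the start of any ray, and every other point is the end of its own. Excluding s =
  -- 1/2 keeps the nearby points different from the midpoint m, so that paths to m are non-constant.
  have key : ∃ b ∈ poleBall n, b ≠ 0 ∧ ∃ s ∈ Icc (0 : ℝ) 1, s ≠ 1 / 2 ∧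
      roughShear i j (s • b) = p := by
    obtain ⟨b, hb, rfl⟩ := hp
    rcases eq_or_ne b 0 with rfl | h0
    · refine ⟨_, openPoleBall_subset half_firstVec_mem, fun h => ?_, 0, by simp, by norm_num,
        by simp⟩
      have := pos_of_mem_openPoleBall (half_firstVec_mem (n := n))
      rw [h] at this
      exact lt_irrefl _ this
    · exact ⟨b, hb, h0, 1, by simp, by norm_num, by simp⟩
  obtain ⟨b, hb, h0, s, hs, hs2, rfl⟩ := key
  refine ⟨roughShear i j ((1 / 2 : ℝ) • b), roughShear_ray_mem hb h0 (by norm_num) (by norm_num),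
    _, eVariationOn_Icc_lt_top (contDiff_roughShear_ray (i := i) (j := j) b),
    (frequently_ray hb h0 hs (eventually_ne_nhds hs2)).mono ?_⟩
  rintro q ⟨t, ht, ht2, rfl⟩
  exact ⟨roughShear_ray_ne hj hb h0 ht2, joinedSmoothly_ray hb h0 ht (by norm_num)⟩

theorem liminf_pathInfLength_lt_top (hj : 0 ≠ j) (hij : i ≠ j) {p q : EuclideanSpace ℝ (Fin n)}
    (hp : p ∈ roughBall i j) (hq : q ∈ roughBall i j) :
    liminf (fun z : EuclideanSpace ℝ (Fin n) × EuclideanSpace ℝ (Fin n) =>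
      pathInfLength (roughInterior i j) z.1 z.2)
      (𝓝[roughInterior i j] p ×ˢ 𝓝[roughInterior i j] q) < ⊤ := by
  obtain ⟨m, hm, M, hM, hf⟩ := exists_frequently_joinedSmoothly hj hp
  obtain ⟨m', hm', M', hM', hf'⟩ := exists_frequently_joinedSmoothly hj hq
  obtain ⟨L, hL, hmm⟩ := exists_joinedSmoothly (isOpen_roughInterior hj hij)
    isPreconnected_roughInterior hm hm'
  refine (liminf_le_of_frequently_le' ((frequently_prod_and.2 ⟨hf, hf'⟩).mono
    fun z hz => ?_)).trans_lt (ENNReal.add_lt_top.2 ⟨hM, ENNReal.add_lt_top.2 ⟨hL, hM'⟩⟩)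
  exact hz.1.2.pathInfLength_trans_le (hmm.trans hz.2.2.symm) hz.1.1

/-- The shear is the identity on the ray through `b` if `b j = 0` and the rough function vanishes at
the slope of `b`. -/
theorem eVariationOn_flat_ray_le {b : EuclideanSpace ℝ (Fin n)} (hbj : b j = 0)
    (hw : roughFun (b i / b 0) = 0) :
    eVariationOn (fun t : ℝ => roughShear i j (t • b)) (Icc 0 1) ≤ ENNReal.ofReal ‖b‖ := by
  refine le_of_eq_of_le (congrArg (eVariationOn · _) (funext fun t => ?_)) (eVariationOn_segment_le b)
  rcases eq_or_ne t 0 with rfl | ht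
  · simp [roughShear_zero]
  · simp [roughShear, hbj, mul_div_mul_left _ _ ht, hw]

theorem roughShear_eq_self {b : EuclideanSpace ℝ (Fin n)} (hbj : b j = 0)
    (hw : roughFun (b i / b 0) = 0) : roughShear i j b = b := by
  simp [roughShear, hbj, hw]

theorem joinedSmoothly_flat_ray {b : EuclideanSpace ℝ (Fin n)} (hb : b ∈ openPoleBall n)
    (hbj : b j = 0) (hw : roughFun (b i / b 0) = 0) {t : ℝ} (ht : t ∈ Ioo (0 : ℝ) 1) :
    JoinedSmoothly (roughInterior i j) (ENNReal.ofReal ‖b‖) b (roughShear i j (t • b)) := by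
  have h := joinedSmoothly_of_curve (U := roughInterior i j)
    (contDiff_roughShear_ray (i := i) (j := j) b) (a := 1) (b := t) (by simp)
    (Ioo_subset_Icc_self ht) fun r hr => ?_
  · rw [one_smul, roughShear_eq_self hbj hw] at h
    obtain ⟨γ, h1, h2, h3, h4, h5⟩ := h
    exact ⟨γ, h1, h2, h3, h4, h5.trans (eVariationOn_flat_ray_le hbj hw)⟩
  · rw [uIcc_of_ge ht.2.le] at hr
    rcases hr.2.eq_or_lt with rfl | hr1
    · rw [one_smul]; exact mem_image_of_mem _ hb
    · refine roughShear_ray_mem (openPoleBall_subset hb) (fun h0 => ?_) (ht.1.trans_le hr.1) hr1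
      have := pos_of_mem_openPoleBall hb
      rw [h0] at this
      exact lt_irrefl _ this

theorem frequently_flat_ray (hj : 0 ≠ j) {b : EuclideanSpace ℝ (Fin n)} (hb : b ∈ openPoleBall n)
    (hbj : b j = 0) (hw : roughFun (b i / b 0) = 0) :
    ∃ᶠ q in 𝓝[roughInterior i j] 0,
      b ≠ q ∧ JoinedSmoothly (roughInterior i j) (ENNReal.ofReal ‖b‖) b q := by
  have h0 : b ≠ 0 := fun h0 => by
    have := pos_of_mem_openPoleBall hb
    rw [h0] at this
    exact lt_irrefl _ this
  have h := frequently_ray (i := i) (j := j) (openPoleBall_subset hb) h0 (s := 0) (by simp)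
    (P := fun _ => True) (by simp)
  rw [zero_smul, roughShear_zero] at h
  refine h.mono ?_
  rintro q ⟨t, ht, -, rfl⟩
  refine ⟨?_, joinedSmoothly_flat_ray hb hbj hw ht⟩
  have := roughShear_ray_ne (i := i) hj (openPoleBall_subset hb) h0 ht.2.ne'
  rwa [one_smul, roughShear_eq_self hbj hw] at this

theorem liminf_pathInfLength_flat_ray_le (hj : 0 ≠ j) {b : EuclideanSpace ℝ (Fin n)}
    (hb : b ∈ openPoleBall n) (hbj : b j = 0) (hw : roughFun (b i / b 0) = 0) :
    liminf (fun z : EuclideanSpace ℝ (Fin n) × EuclideanSpace ℝ (Fin n) =>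
      pathInfLength (roughInterior i j) z.1 z.2)
      (𝓝[roughInterior i j] b ×ˢ 𝓝[roughInterior i j] 0) ≤ ENNReal.ofReal ‖b‖ ∧
    liminf (fun z : EuclideanSpace ℝ (Fin n) × EuclideanSpace ℝ (Fin n) =>
      pathInfLength (roughInterior i j) z.1 z.2)
      (𝓝[roughInterior i j] 0 ×ˢ 𝓝[roughInterior i j] b) ≤ ENNReal.ofReal ‖b‖ := by
  have hbU : b ∈ roughInterior i j := ⟨b, hb, roughShear_eq_self hbj hw⟩
  have h := frequently_flat_ray (i := i) hj hb hbj hw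
  constructor
  · refine liminf_le_of_frequently_le' ((frequently_prod_and.2
      ⟨frequently_eq_of_mem hbU, h⟩).mono fun z hz => ?_)
    rw [hz.1]
    exact hz.2.2.pathInfLength_le hz.2.1
  · refine liminf_le_of_frequently_le' ((frequently_prod_and.2
      ⟨h, frequently_eq_of_mem hbU⟩).mono fun z hz => ?_)
    rw [hz.2]
    exact hz.1.2.symm.pathInfLength_le hz.1.1.symm

end Shear

/-! ### The cost of changing the slope -/

section Crossing

variable {n : ℕ} [NeZero n] {i j : Fin n}

/-- The scale at which the rough function is steep enough for a given first coordinate. -/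
theorem exists_rough_scale {x : ℝ} (hx0 : 0 < x) (hx1 : x < 1) :
    ∃ N : ℕ, 256 ≤ 3 ^ N * x ∧ x / 768 ≤ (1 / 2 : ℝ) ^ N := by
  -- With N = k + 1 the product 3^N x lies between 256 and 768 = 3 · 256; the upper bound gives x /
  -- 768 ≤ 3^(-N) ≤ 2^(-N).
  obtain ⟨k, hk1, hk2⟩ := exists_nat_pow_near (x := 256 / x) (y := 3)
    (by rw [le_div_iff₀ hx0]; linarith) (by norm_num)
  refine ⟨k + 1, by rw [div_lt_iff₀ hx0] at hk2; exact hk2.le, ?_⟩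
  rw [le_div_iff₀ hx0] at hk1
  have h1 : (1 / 3 : ℝ) ^ (k + 1) ≤ (1 / 2) ^ (k + 1) := by gcongr; norm_num
  refine le_trans ?_ h1
  have h3 : (0 : ℝ) < 3 ^ k := by positivity
  rw [one_div, inv_pow, pow_succ, mul_inv, div_le_iff₀ (by norm_num)]
  have : ((3 : ℝ) ^ k)⁻¹ * 3⁻¹ * 768 = 256 / 3 ^ k := by field_simp; norm_num
  rw [this, le_div_iff₀ h3]
  linarith

/-- A half-cell of length `6⁻ᴺ / 2` fits into every interval of length `2 * 6⁻ᴺ`. -/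
theorem exists_cell_mem_uIcc {N : ℕ} {a b : ℝ} (hab : 2 / 6 ^ N ≤ |b - a|) :
    ∃ m : ℤ, (m / 6 ^ N : ℝ) ∈ uIcc a b ∧ ((m + 1 / 2) / 6 ^ N : ℝ) ∈ uIcc a b := by
  have h6 : (0 : ℝ) < 6 ^ N := by positivity
  have hlen : 2 / 6 ^ N ≤ max a b - min a b := by rwa [max_sub_min_eq_abs]
  rw [div_le_iff₀ h6] at hlen
  have hc1 := Int.le_ceil (min a b * 6 ^ N)
  have hc2 := Int.ceil_lt_add_one (min a b * 6 ^ N)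
  refine ⟨⌈min a b * 6 ^ N⌉, ⟨?_, ?_⟩, ⟨?_, ?_⟩⟩
  · rw [le_div_iff₀ h6]; exact hc1
  · rw [div_le_iff₀ h6]; nlinarith
  · rw [le_div_iff₀ h6]; linarith
  · rw [div_le_iff₀ h6]; nlinarith

theorem le_dist_of_cell {N : ℕ} {m : ℤ} {x : ℝ} {p q : EuclideanSpace ℝ (Fin n)} (hx0 : 0 < x)
    (hN1 : 256 ≤ 3 ^ N * x) (hN2 : x / 768 ≤ (1 / 2 : ℝ) ^ N)
    (hp : |p 0 - x| ≤ x / 2) (hq : |q 0 - x| ≤ x / 2)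
    (hpj : |p j - p 0 * roughFun (p i / p 0)| ≤ p 0 ^ 2 / 60000)
    (hqj : |q j - q 0 * roughFun (q i / q 0)| ≤ q 0 ^ 2 / 60000)
    (hpm : p i / p 0 = m / 6 ^ N) (hqm : q i / q 0 = (m + 1 / 2) / 6 ^ N) :
    8 / 6 ^ N ≤ dist p q := by
  have hosc := roughFun_oscillation N m
  rw [← hpm, ← hqm] at hosc
  have hcoord (k : Fin n) : |q k - p k| ≤ dist p q := by
    rw [dist_comm, dist_eq_norm]; exact PiLp.norm_apply_le (q - p) k
  have h0 := abs_le.1 (hcoord 0)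
  have hj := abs_le.1 (hcoord j)
  rw [abs_le] at hp hq hpj hqj
  set a := roughFun (p i / p 0)
  set b := roughFun (q i / q 0)
  set d := dist p q
  have hb : |b| ≤ 1 := abs_roughFun_le _
  -- Write q₀ b − p₀ a = p₀ (b − a) − (p₀ − q₀) b. Since |b| ≤ 1, a difference in height can hide at
  -- most d of the oscillation.
  have hprod : (p 0 - q 0) * b ≤ d := by
    calc (p 0 - q 0) * b ≤ |(p 0 - q 0) * b| := le_abs_self _
      _ = |q 0 - p 0| * |b| := by rw [abs_mul, abs_sub_comm]
      _ ≤ d * 1 := mul_le_mul (hcoord 0) hb (abs_nonneg _) dist_nonneg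
      _ = d := mul_one d
  have hp2 : p 0 ^ 2 ≤ 9 / 4 * x ^ 2 := by nlinarith
  have hq2 : q 0 ^ 2 ≤ 9 / 4 * x ^ 2 := by nlinarith
  have hgain : x / 2 * ((1 / 2 : ℝ) ^ N / 4) ≤ p 0 * (b - a) := by
    apply mul_le_mul (by linarith) hosc (by positivity) (by linarith)
  have hx2 : x * (x / 768) ≤ x * (1 / 2 : ℝ) ^ N := by gcongr
  -- Altogether 2d ≥ x 2^(-N) / 8 − (9/2) x² / 60000. As x ≤ 768 · 2^(-N), the constant 60000 makes
  -- the thickness term at most half of the first term.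
  have hd : x * (1 / 2 : ℝ) ^ N / 32 ≤ d := by nlinarith
  refine le_trans ?_ hd
  have h2 : (1 / 2 : ℝ) ^ N = 3 ^ N / 6 ^ N := by rw [← div_pow]; norm_num
  rw [h2, div_le_iff₀ (by positivity)]
  have : x * (3 ^ N / 6 ^ N) / 32 * 6 ^ N = 3 ^ N * x / 32 := by field_simp
  rw [this]; linarith

/-- The first time at which a nonnegative continuous function reaches the value `1`. -/
theorem exists_first_eq_one {f : ℝ → ℝ} {a b : ℝ} (hf : ContinuousOn f (Icc a b)) (ha : f a < 1)
    {c : ℝ} (hc : c ∈ Icc a b) (hfc : 1 ≤ f c) :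
    ∃ t ∈ Ioc a b, f t = 1 ∧ ∀ s ∈ Icc a t, f s ≤ 1 := by
  have hK : IsCompact (Icc a b ∩ f ⁻¹' {1}) :=
    isCompact_Icc.of_isClosed_subset (hf.preimage_isClosed_of_isClosed isClosed_Icc
      isClosed_singleton) inter_subset_left
  have hivt {e : ℝ} (he : e ∈ Icc a b) (hfe : 1 ≤ f e) : ∃ s ∈ Icc a e, f s = 1 :=
    intermediate_value_Icc he.1 (hf.mono (Icc_subset_Icc_right he.2)) ⟨ha.le, hfe⟩
  obtain ⟨s, hs, hs1⟩ := hivt hc hfc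
  obtain ⟨t, ⟨ht, ht1⟩, hleast⟩ :=
    hK.exists_isLeast ⟨s, ⟨hs.1, hs.2.trans hc.2⟩, hs1⟩
  have ht1 : f t = 1 := ht1
  have hat : a < t := lt_of_le_of_ne ht.1 fun h => by rw [h, ht1] at ha; exact lt_irrefl _ ha
  refine ⟨t, ⟨hat, ht.2⟩, ht1, fun r hr => ?_⟩
  by_contra! hr1
  obtain ⟨e, he, he1⟩ := hivt ⟨hr.1, hr.2.trans ht.2⟩ hr1.le
  have h1 : t ≤ e := hleast ⟨⟨he.1, he.2.trans (hr.2.trans ht.2)⟩, he1⟩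
  have h2 : r = t := le_antisymm hr.2 (h1.trans he.2)
  rw [h2, ht1] at hr1
  exact lt_irrefl _ hr1

/-- A path in a thin neighbourhood of the cone over the graph of the rough function has a length
that controls the slope `p i / p 0`. -/
theorem ofReal_abs_slope_sub_le_eVariationOn {γ : ℝ → EuclideanSpace ℝ (Fin n)}
    (hγ : ContinuousOn γ (Icc 0 1)) (h0 : ∀ t ∈ Icc (0 : ℝ) 1, 0 < γ t 0)
    (h1 : ∀ t ∈ Icc (0 : ℝ) 1, γ t 0 < 1)
    (hj : ∀ t ∈ Icc (0 : ℝ) 1, |γ t j - γ t 0 * roughFun (γ t i / γ t 0)| ≤ γ t 0 ^ 2 / 60000) :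
    ENNReal.ofReal (|4 * (γ 1 i / γ 1 0) - 4 * (γ 0 i / γ 0 0)| - 1 / 32) ≤
      eVariationOn γ (Icc 0 1) := by
  have hcoord (k : Fin n) : ContinuousOn (fun t => γ t k) (Icc 0 1) :=
    (PiLp.continuous_apply 2 _ k).comp_continuousOn hγ
  have hslope : ContinuousOn (fun t => γ t i / γ t 0) (Icc 0 1) :=
    (hcoord i).div (hcoord 0) fun t ht => (h0 t ht).ne'
  refine ofReal_abs_sub_le_eVariationOn (f := fun t => 4 * (γ t i / γ t 0))
    (continuousOn_const.mul hslope) fun t ht => ?_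
  obtain ⟨N, hN1, hN2⟩ := exists_rough_scale (h0 t ht) (h1 t ht)
  have hx := h0 t ht
  set x := γ t 0 with hxdef
  have h6 : (0 : ℝ) < 6 ^ N := by positivity
  have h36 : (3 : ℝ) ^ N ≤ 6 ^ N := by gcongr; norm_num
  have h6x : 256 ≤ 6 ^ N * x := hN1.trans (by gcongr)
  -- The value 1 marks the exit from a box around the current height and slope, with half-widths x /
  -- 2 and 2 / 6^N. Until the exit the height is comparable to x, so the scale N remains valid.
  set f : ℝ → ℝ := fun s => max (|γ s 0 - x| / (x / 2))
    (|γ s i / γ s 0 - γ t i / x| / (2 / 6 ^ N)) with hf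
  have hsub : Icc t 1 ⊆ Icc 0 1 := Icc_subset_Icc_left ht.1
  have hfc : ContinuousOn f (Icc t 1) :=
    ((((hcoord 0).sub continuousOn_const).abs.div_const _).sup
      ((hslope.sub continuousOn_const).abs.div_const _)).mono hsub
  have hft : f t < 1 := by simp [hf, ← hxdef]
  rcases le_or_gt 1 (f 1) with hf1 | hf1
  · left
    obtain ⟨t', ht', hft', hle⟩ := exists_first_eq_one hfc hft ⟨ht.2, le_rfl⟩ hf1
    have hle0 (s : ℝ) (hs : s ∈ Icc t t') : |γ s 0 - x| ≤ x / 2 := by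
      have := (le_max_left _ _).trans (hle s hs)
      rwa [div_le_one (by positivity)] at this
    have hlei (s : ℝ) (hs : s ∈ Icc t t') : |γ s i / γ s 0 - γ t i / x| ≤ 2 / 6 ^ N := by
      have := (le_max_right _ _).trans (hle s hs)
      rwa [div_le_one (by positivity)] at this
    have hsub' : Icc t t' ⊆ Icc 0 1 := (Icc_subset_Icc_right ht'.2).trans hsub
    have htm : t ∈ Icc t t' := ⟨le_rfl, ht'.1.le⟩
    have htm' : t' ∈ Icc t t' := ⟨ht'.1.le, le_rfl⟩
    have key : ∃ r ∈ Icc t t', ∃ s ∈ Icc t t', 8 / 6 ^ N ≤ dist (γ r) (γ s) := by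
      rcases max_choice (|γ t' 0 - x| / (x / 2))
        (|γ t' i / γ t' 0 - γ t i / x| / (2 / 6 ^ N)) with hm | hm
      -- Exit through the height: the displacement x / 2 alone is at least 8 / 6^N.
      · have h2 : |γ t' 0 - x| = x / 2 := by
          have h3 := hm.symm.trans hft'
          rwa [div_eq_one_iff_eq (by positivity)] at h3
        refine ⟨t', htm', t, htm, ?_⟩
        have h3 : |γ t' 0 - x| ≤ dist (γ t') (γ t) := by
          rw [dist_eq_norm]; exact PiLp.norm_apply_le (γ t' - γ t) 0
        refine le_trans ?_ (h2 ▸ h3)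
        rw [div_le_iff₀ h6]
        linarith
      · have h2 : |γ t' i / γ t' 0 - γ t i / x| = 2 / 6 ^ N := by
          have h3 := hm.symm.trans hft'
          rwa [div_eq_one_iff_eq (by positivity)] at h3
        -- Exit through the slope: by the intermediate value theorem the path visits both ends of a
        -- half-cell, whose points are at distance at least 8 / 6^N, four times the change of slope.
        obtain ⟨m, hma, hmb⟩ := exists_cell_mem_uIcc h2.ge
        have himg : uIcc (γ t i / x) (γ t' i / γ t' 0) ⊆
            (fun s => γ s i / γ s 0) '' Icc t t' := by
          have := intermediate_value_uIcc (a := t) (b := t') (f := fun s => γ s i / γ s 0)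
            ((hslope.mono hsub').mono (by rw [uIcc_of_le ht'.1.le]))
          rwa [uIcc_of_le ht'.1.le] at this
        obtain ⟨r, hr, hrm⟩ := himg hma
        obtain ⟨s, hs, hsm⟩ := himg hmb
        exact ⟨r, hr, s, hs, le_dist_of_cell hx hN1 hN2 (hle0 r hr) (hle0 s hs)
          (hj r (hsub' hr)) (hj s (hsub' hs)) hrm hsm⟩
    obtain ⟨r, hr, s, hs, hrs⟩ := key
    refine ⟨t', ht', le_trans ?_ (eVariationOn.edist_le γ hr hs)⟩
    rw [edist_dist]
    apply ENNReal.ofReal_le_ofReal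
    refine le_trans ?_ hrs
    change |4 * (γ t' i / γ t' 0) - 4 * (γ t i / x)| ≤ _
    rw [← mul_sub, abs_mul, abs_of_pos (by norm_num : (0 : ℝ) < 4)]
    have := hlei t' htm'
    calc 4 * |γ t' i / γ t' 0 - γ t i / x| ≤ 4 * (2 / 6 ^ N) := by gcongr
      _ = 8 / 6 ^ N := by ring
  -- The end of the path is in the box, so the remaining error is at most 8 / 6^N ≤ 8 / 256 = 1/32.
  · right
    have := (le_max_right _ _).trans_lt hf1
    rw [div_lt_one (by positivity)] at this
    change |4 * (γ 1 i / γ 1 0) - 4 * (γ t i / x)| ≤ _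
    rw [← mul_sub, abs_mul, abs_of_pos (by norm_num : (0 : ℝ) < 4)]
    have h256 : (256 : ℝ) ≤ 6 ^ N := by nlinarith [h1 t ht]
    have h7 : (2 : ℝ) / 6 ^ N ≤ 2 / 256 := by gcongr
    linarith

/-- In the interior of the rough ball it is expensive to change the slope `p i / p 0`. -/
theorem one_le_pathInfLength (hj : 0 ≠ j) (hij : i ≠ j) {p q : EuclideanSpace ℝ (Fin n)}
    (hp : p i / p 0 < 1 / 4) (hq : 3 / 4 < q i / q 0) :
    1 ≤ pathInfLength (roughInterior i j) p q := by
  refine le_iInf₂ fun γ hγ => ?_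
  have h (t : ℝ) (ht : t ∈ Icc (0 : ℝ) 1) : 0 < γ t 0 ∧ γ t 0 < 1 ∧
      |γ t j - γ t 0 * roughFun (γ t i / γ t 0)| ≤ γ t 0 ^ 2 / 60000 := by
    obtain ⟨b, hb, hbt⟩ := hγ.mapsTo ht
    have hn := norm_lt_one_of_mem_openPoleBall hb
    have hb0 : b 0 ≤ ‖b‖ := (le_abs_self _).trans (PiLp.norm_apply_le b 0)
    have hbj : |b j| ≤ ‖b‖ := PiLp.norm_apply_le b j
    rw [← hbt, roughShear_apply_self, roughShear_apply_of_ne hj, roughShear_apply_of_ne hij]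
    refine ⟨pos_of_mem_openPoleBall hb, by linarith, ?_⟩
    rw [add_sub_cancel_right, abs_mul, abs_of_nonneg (by positivity)]
    exact mul_le_of_le_one_right (by positivity) (by linarith)
  refine le_trans ?_ (ofReal_abs_slope_sub_le_eVariationOn (i := i) (j := j) hγ.smooth.continuousOn
    (fun t ht => (h t ht).1) (fun t ht => (h t ht).2.1) fun t ht => (h t ht).2.2)
  rw [hγ.source, hγ.target, ← ENNReal.ofReal_one]
  apply ENNReal.ofReal_le_ofReal
  -- The slope changes by more than 1/2, and 4 · (1/2) − 1/32 ≥ 1.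
  have := le_abs_self (4 * (q i / q 0) - 4 * (p i / p 0))
  linarith

theorem one_le_liminf_pathInfLength (hj : 0 ≠ j) (hij : i ≠ j)
    {p q : EuclideanSpace ℝ (Fin n)} (hp0 : p 0 ≠ 0) (hq0 : q 0 ≠ 0)
    (hp : p i / p 0 < 1 / 4) (hq : 3 / 4 < q i / q 0) :
    1 ≤ liminf (fun z : EuclideanSpace ℝ (Fin n) × EuclideanSpace ℝ (Fin n) =>
      pathInfLength (roughInterior i j) z.1 z.2)
      (𝓝[roughInterior i j] p ×ˢ 𝓝[roughInterior i j] q) := by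
  have hc {r : EuclideanSpace ℝ (Fin n)} (hr : r 0 ≠ 0) :
      ContinuousAt (fun r : EuclideanSpace ℝ (Fin n) => r i / r 0) r :=
    ContinuousAt.div (by fun_prop) (by fun_prop) hr
  refine le_liminf_of_le (by isBoundedDefault) ?_
  have h1 : ∀ᶠ r in 𝓝[roughInterior i j] p, r i / r 0 < 1 / 4 :=
    nhdsWithin_le_nhds ((hc hp0).eventually_lt continuousAt_const hp)
  have h2 : ∀ᶠ r in 𝓝[roughInterior i j] q, 3 / 4 < r i / r 0 :=
    nhdsWithin_le_nhds (continuousAt_const.eventually_lt (hc hq0) hq)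
  filter_upwards [h1.prod_mk h2] with z hz
  exact one_le_pathInfLength hj hij hz.1 hz.2

end Crossing

/-! ### The counterexample -/

theorem theorem2p2 (n : ℕ) [NeZero n] (hn : 3 ≤ n) :
    ∃ (Y : Set (EuclideanSpace ℝ (Fin n))) (_ : ChartedSpace (EuclideanHalfSpace n) Y),
      IsManifold (𝓡∂ n) 0 Y ∧
      IsCompact Y ∧
      IsConnected Y ∧
      Nonempty (Y ≃ₜ Metric.closedBall (0 : EuclideanSpace ℝ (Fin n)) 1) ∧
      (manifoldBdry Y).Nonempty ∧
      RhoFinite Y ∧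
      ∃ A ∈ manifoldInt Y, ∃ D ∈ manifoldInt Y, ∃ O ∈ manifoldBdry Y,
        rhoY Y A O + rhoY Y O D < rhoY Y A D := by
  obtain ⟨i, j, hi, hj, hij⟩ : ∃ i j : Fin n, 0 ≠ i ∧ 0 ≠ j ∧ i ≠ j := by
    refine ⟨⟨1, by omega⟩, ⟨2, by omega⟩, ?_, ?_, ?_⟩ <;> simp [Fin.ext_iff]
  let := poleBallChartedSpace (roughBallHomeo (i := i) hj hij)
  have hint : manifoldInt (roughBall i j) = roughInterior i j := manifoldInt_roughBall hj hij
  have hbd : (0 : EuclideanSpace ℝ (Fin n)) ∈ manifoldBdry (roughBall i j) :=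
    zero_mem_manifoldBdry_roughBall hj hij
  set A : EuclideanSpace ℝ (Fin n) := (1 / 4 : ℝ) • firstVec n with hA
  set D : EuclideanSpace ℝ (Fin n) := A + EuclideanSpace.single i (1 / 4 : ℝ) with hD
  have hA0 : A 0 = 1 / 4 := by simp [hA, firstVec_zero]
  have hAk (k : Fin n) (hk : 0 ≠ k) : A k = 0 := by simp [hA, firstVec, hk.symm]
  have hD0 : D 0 = 1 / 4 := by simp [hD, hA0, hi]
  have hDi : D i = 1 / 4 := by simp [hD, hAk i hi]
  have hDj : D j = 0 := by simp [hD, hAk j hj, hij.symm]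
  have hAn : ‖A‖ = 1 / 4 := by
    rw [hA, norm_smul, norm_firstVec]; norm_num
  have hDn : ‖D‖ ^ 2 = 1 / 8 := by
    rw [hD, norm_add_sq_real, hAn, EuclideanSpace.inner_single_right, hAk i hi,
      PiLp.norm_single]
    norm_num
  have hAball : A ∈ openPoleBall n := by
    change ‖A‖ ^ 2 < A 0
    rw [hA0, hAn]; norm_num
  have hDball : D ∈ openPoleBall n := by
    change ‖D‖ ^ 2 < D 0
    rw [hD0, hDn]; norm_num
  have hwA : roughFun (A i / A 0) = 0 := by
    rw [hAk i hi, zero_div]; simpa using roughFun_intCast 0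
  have hwD : roughFun (D i / D 0) = 0 := by
    rw [hDi, hD0, div_self (by norm_num)]; simpa using roughFun_intCast 1
  -- For smoothness degree 0 every charted space is a manifold, so the charts need no compatibility
  -- check.
  refine ⟨roughBall i j, inferInstance, inferInstance,
    isCompact_poleBall.image continuous_roughShear, isConnected_roughBall,
    ⟨(roughBallHomeo hj hij).trans closedBallHomeoPoleBall.symm⟩, ⟨0, hbd⟩,
    fun p hp q hq => ?_, A, ?_, D, ?_, 0, hbd, ?_⟩
  · rw [rhoY, hint]
    exact liminf_pathInfLength_lt_top hj hij hp hq
  · rw [hint]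
    exact ⟨A, hAball, roughShear_eq_self (hAk j hj) hwA⟩
  · rw [hint]
    exact ⟨D, hDball, roughShear_eq_self hDj hwD⟩
  · simp only [rhoY, hint]
    have h1 := (liminf_pathInfLength_flat_ray_le hj hAball (hAk j hj) hwA).1
    have h2 := (liminf_pathInfLength_flat_ray_le hj hDball hDj hwD).2
    have h3 := one_le_liminf_pathInfLength (p := A) (q := D) (i := i) hj hij
      (by rw [hA0]; norm_num) (by rw [hD0]; norm_num) (by rw [hAk i hi]; norm_num)
      (by rw [hDi, hD0]; norm_num)
    -- The radial detour costs 1/4 + 1/√8 < 1, and the direct crossing at least 1.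
    refine ((add_le_add h1 h2).trans_lt ?_).trans_le h3
    rw [← ENNReal.ofReal_add (norm_nonneg _) (norm_nonneg _), ENNReal.ofReal_lt_one, hAn]
    nlinarith [norm_nonneg D]
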